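/- Let $p$ be a prime, let $a\ge b\ge 1$ be integers, and let $l\ge 0$ be an integer with $p^l\le b$. Put $v=a+b$ and $t=b-p^l$. Write $[v]^s$ for the set of $s$-element subsets of $[v]=\{1,\dots,v\}$, and let $a_l\in\{0,\dots,p-1\}$ be the coefficient of $p^l$ in the base $p$ expansion of $a$ (so $a_l=0$ if $p^l>a$). A non-null $p$-ary $t$-design for $(a,b)$ is a function $u:[v]^b\to\mathbb{F}_p$ for which there is a nonzero $\mu\in\mathbb{F}_p$ such that $$\sum_{Y\in[v]^b,\ Y\supseteq Z}u(Y)=\mu\qquad\text{for all } Z\in[v]^t.$$ Then a non-null $p$-ary $(b-p^l)$-design for $(a,b)$ exists if and only if $$a_l\not\equiv -1 \pmod p\quad\text{or}\quad b<p^{l+1}.$$ -/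

import Mathlib

/-- A block of size `s` on the point set `[v]`: an `s`-element subset of a fixed `v`-element set. -/
abbrev DesignBlock (v s : ℕ) : Type := {Y : Finset (Fin v) // Y.card = s}

/-- The function `û` induced from `u` on the subsets of `[v]`: `û(Z) = ∑_{Y ⊇ Z} u(Y)`,
where `Y` runs over the blocks of size `s`. -/
def inducedFun {R : Type*} [AddCommMonoid R] {v s : ℕ} (u : DesignBlock v s → R)
    (Z : Finset (Fin v)) : R :=
  ∑ Y : DesignBlock v s with Z ⊆ Y.1, u Y

/-- `u` is a `t`-design on `[v]` of constant block size `s`, with values in `R` and with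
coefficient `μ`: every `t`-element subset `Z` of `[v]` satisfies `û(Z) = μ`.
For `t ≤ v` there is such a `Z`, so the coefficient is unique. -/
def IsDesignWithCoeff {R : Type*} [AddCommMonoid R] {v s : ℕ} (u : DesignBlock v s → R)
    (t : ℕ) (μ : R) : Prop :=
  ∀ Z : Finset (Fin v), Z.card = t → inducedFun u Z = μ

/-- `u` is a non-null `t`-design: a `t`-design whose coefficient is nonzero. -/
def IsNonNullDesign {R : Type*} [AddCommMonoid R] {v s : ℕ} (u : DesignBlock v s → R)
    (t : ℕ) : Prop :=
  ∃ μ : R, μ ≠ 0 ∧ IsDesignWithCoeff u t μ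

/-- The digit `a_l` in the base `p` expansion `a = ∑ i, a_i p ^ i`
(it is `0` beyond the leading digit). -/
def baseDigit (p a l : ℕ) : ℕ := (Nat.digits p a).getD l 0

/-! Necessity is double counting above a set of size `b - p ^ (l + 1)`: if `a_l = p - 1`, Lucas
makes the factor of `μ` equal to 1 and the other side 0, so `μ = 0`. If `a_l ≠ p - 1`, the constant
function 1 is a design with coefficient `a_l + 1 ≠ 0` mod `p`. If `b < p ^ (l + 1)`, all binomials
`(b - i).choose (t - i)` are units mod `p`, and then `inducedLinearMap_surjective` yields a design
with coefficient 1. -/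

/-- A digit form of Lucas' theorem for a lower index of the shape `k * p ^ l` with `k < p`. -/
theorem choose_mul_prime_pow_modEq {p : ℕ} (hp : p.Prime) (n k l : ℕ) (hk : k < p) :
    Nat.choose n (k * p ^ l) ≡ Nat.choose (n / p ^ l % p) k [MOD p] := by
  have := Fact.mk hp
  induction l generalizing n with
  | zero =>
    have h := Choose.choose_modEq_choose_mod_mul_choose_div_nat (n := n) (k := k) (p := p)
    simpa [Nat.mod_eq_of_lt hk, Nat.div_eq_of_lt hk] using h
  | succ l ih =>
    have h := Choose.choose_modEq_choose_mod_mul_choose_div_nat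
      (n := n) (k := k * p ^ (l + 1)) (p := p)
    have e : k * p ^ (l + 1) = (k * p ^ l) * p := by ring
    rw [e, Nat.mul_mod_left, Nat.mul_div_cancel _ hp.pos, Nat.choose_zero_right, one_mul] at h
    rw [e]
    refine h.trans ?_
    have := ih (n / p)
    rwa [Nat.div_div_eq_div_mul, ← pow_succ'] at this

theorem card_filter_superset_powersetCard {α : Type*} [DecidableEq α] {X Y : Finset α}
    (h : X ⊆ Y) {t : ℕ} (ht : X.card ≤ t) :
    ((Y.powersetCard t).filter (X ⊆ ·)).card = (Y.card - X.card).choose (t - X.card) := by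
  rw [← Finset.card_sdiff_of_subset h, ← Finset.card_powersetCard]
  refine Finset.card_bij' (fun Z _ => Z \ X) (fun W _ => W ∪ X) ?_ ?_ ?_ ?_
  · intro Z hZ
    simp only [Finset.mem_filter, Finset.mem_powersetCard] at hZ ⊢
    exact ⟨Finset.sdiff_subset_sdiff hZ.1.1 le_rfl, by
      rw [Finset.card_sdiff_of_subset hZ.2, hZ.1.2]⟩
  · intro W hW
    simp only [Finset.mem_filter, Finset.mem_powersetCard, Finset.subset_sdiff] at hW ⊢
    refine ⟨⟨Finset.union_subset hW.1.1 h, ?_⟩, Finset.subset_union_right⟩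
    rw [Finset.card_union_of_disjoint hW.1.2, hW.2]
    omega
  · intro Z hZ
    simp only [Finset.mem_filter] at hZ
    exact Finset.sdiff_union_of_subset hZ.2
  · intro W hW
    simp only [Finset.mem_powersetCard, Finset.subset_sdiff] at hW
    exact Finset.union_sdiff_cancel_right hW.1.2

/-- A function on `t`-subsets of `A` that is invariant under exchanging one element is constant. -/
theorem eq_of_exchange_invariant {α β : Type*} [DecidableEq α] {A : Finset α} {t : ℕ}
    (f : Finset α → β)
    (hf : ∀ x ∈ A, ∀ y ∈ A, x ≠ y → ∀ T ⊆ (A.erase x).erase y, T.card = t →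
      f (insert x T) = f (insert y T))
    {Z Z' : Finset α} (hZ : Z ⊆ A) (hZ' : Z' ⊆ A) (cZ : Z.card = t + 1) (cZ' : Z'.card = t + 1) :
    f Z = f Z' := by
  induction hn : (Z \ Z').card generalizing Z with
  | zero =>
    rw [Finset.card_eq_zero, Finset.sdiff_eq_empty_iff_subset] at hn
    rw [Finset.eq_of_subset_of_card_le hn (by omega)]
  | succ n ih =>
    have hc : (Z' \ Z).card = (Z \ Z').card := Finset.card_sdiff_comm (by omega)
    obtain ⟨x, hx⟩ := Finset.card_pos.1 (show 0 < (Z \ Z').card by omega)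
    obtain ⟨y, hy⟩ := Finset.card_pos.1 (show 0 < (Z' \ Z).card by omega)
    rw [Finset.mem_sdiff] at hx hy
    have hxy : x ≠ y := fun e => hy.2 (e ▸ hx.1)
    have hyT : y ∉ Z.erase x := fun h => hy.2 (Finset.mem_of_mem_erase h)
    have cT : (Z.erase x).card = t := by rw [Finset.card_erase_of_mem hx.1, cZ]; rfl
    have h1 := hf x (hZ hx.1) y (hZ' hy.1) hxy (Z.erase x)
      (Finset.subset_erase.2 ⟨Finset.erase_subset_erase x hZ, hyT⟩) cT
    rw [Finset.insert_erase hx.1] at h1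
    rw [h1]
    refine ih (Finset.insert_subset (hZ' hy.1) ((Finset.erase_subset _ _).trans hZ)) ?_ ?_
    · rw [Finset.card_insert_of_notMem hyT, cT]
    · rw [Finset.insert_sdiff_of_mem _ hy.1, Finset.erase_sdiff_comm,
        Finset.card_erase_of_mem (Finset.mem_sdiff.2 hx), hn]
      rfl

/-- A function on `t`-subsets is determined by its sums over the `b`-sets, provided the binomial
coefficients `(b - i).choose (t - i)` are invertible. -/
theorem eq_zero_of_sum_powersetCard_eq_zero {α F : Type*} [DecidableEq α] [Field F]
    (t b : ℕ) (A : Finset α) (f : Finset α → F) (htb : t ≤ b) (hA : t + b ≤ A.card)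
    (hc : ∀ i ≤ t, ((b - i).choose (t - i) : F) ≠ 0)
    (hf : ∀ Y ⊆ A, Y.card = b → ∑ Z ∈ Y.powersetCard t, f Z = 0) :
    ∀ Z ⊆ A, Z.card = t → f Z = 0 := by
  induction t generalizing b A f with
  | zero =>
    intro Z _ cZ
    obtain ⟨Y, hY, cY⟩ := Finset.exists_subset_card_eq (show b ≤ A.card by omega)
    rw [Finset.card_eq_zero.1 cZ]
    simpa using hf Y hY cY
  | succ t ih =>
    obtain ⟨b, rfl⟩ : ∃ c, b = c + 1 := ⟨b - 1, by omega⟩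
    have hex : ∀ x ∈ A, ∀ y ∈ A, x ≠ y → ∀ T ⊆ (A.erase x).erase y, T.card = t →
        f (insert x T) = f (insert y T) := by
      intro x hx y hy hxy T hT cT
      have hy' : y ∈ A.erase x := Finset.mem_erase.2 ⟨hxy.symm, hy⟩
      -- Exchange differences satisfy the same hypotheses with `t` and `b` lowered by one and two
      -- points removed from `A`.
      refine sub_eq_zero.1 (ih b ((A.erase x).erase y) (fun T => f (insert x T) - f (insert y T))
        (by omega) ?_ ?_ ?_ T hT cT)
      · rw [Finset.card_erase_of_mem hy', Finset.card_erase_of_mem hx]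
        omega
      · intro i hi
        simpa using hc (i + 1) (by omega)
      · intro R hR cR
        -- Split by whether `z` is contained: the part avoiding `z` is the same for `x` and `y`, so
        -- it cancels.
        have key : ∀ z ∈ A, z ∉ R →
            ∑ T ∈ R.powersetCard (t + 1), f T + ∑ T ∈ R.powersetCard t, f (insert z T) = 0 := by
          intro z hz hzR
          have h := hf (insert z R) (Finset.insert_subset hz (hR.trans
            ((Finset.erase_subset _ _).trans (Finset.erase_subset _ _))))
            (by rw [Finset.card_insert_of_notMem hzR, cR])
          rw [Finset.powersetCard_succ_insert hzR, Finset.sum_union, Finset.sum_image] at h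
          · exact h
          · intro T hT T' hT' e
            have hzT : z ∉ T := fun h => hzR ((Finset.mem_powersetCard.1 hT).1 h)
            have hzT' : z ∉ T' := fun h => hzR ((Finset.mem_powersetCard.1 hT').1 h)
            rw [← Finset.erase_insert hzT, ← Finset.erase_insert hzT']
            exact congrArg (·.erase z) e
          · rw [Finset.disjoint_left]
            intro T hT hT'
            obtain ⟨S, -, rfl⟩ := Finset.mem_image.1 hT'
            exact hzR ((Finset.mem_powersetCard.1 hT).1 (Finset.mem_insert_self z S))
        have hxR := key x hx fun h => by simpa using hR h
        have hyR := key y hy fun h => by simpa using hR h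
        rw [Finset.sum_sub_distrib]
        linear_combination hxR - hyR
    intro Z hZ cZ
    obtain ⟨Y, hY, cY⟩ := Finset.exists_subset_card_eq (show b + 1 ≤ A.card by omega)
    have h := hf Y hY cY
    rw [Finset.sum_congr rfl fun S hS =>
      have hS := Finset.mem_powersetCard.1 hS
      eq_of_exchange_invariant f hex (hS.1.trans hY) hZ hS.2 cZ] at h
    rw [Finset.sum_const, Finset.card_powersetCard, cY, nsmul_eq_mul] at h
    exact (mul_eq_zero.1 h).resolve_left (by simpa using hc 0 (by omega))

/-- The map `u ↦ û` from functions on `b`-sets to functions on `t`-sets. -/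
noncomputable def inducedLinearMap (F : Type*) [Field F] (v b t : ℕ) :
    (DesignBlock v b → F) →ₗ[F] (DesignBlock v t → F) where
  toFun u Z := inducedFun u Z.1
  map_add' u w := by
    ext Z
    simp [inducedFun, Finset.sum_add_distrib]
  map_smul' c u := by
    ext Z
    simp [inducedFun, Finset.mul_sum]

theorem inducedFun_single {F : Type*} [Field F] {v b : ℕ} (Y : DesignBlock v b)
    (Z : Finset (Fin v)) :
    inducedFun (Pi.single Y (1 : F)) Z = if Z ⊆ Y.1 then 1 else 0 := by
  simp [inducedFun, Pi.single_apply]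

theorem sum_designBlock {M : Type*} [AddCommMonoid M] {v t : ℕ} (g : Finset (Fin v) → M) :
    ∑ Z : DesignBlock v t, g Z.1 = ∑ Z ∈ Finset.univ.powersetCard t, g Z :=
  (Finset.sum_subtype _ (fun Z => by simp) g).symm

/-- By duality: a functional killing the range, read on basis vectors, is a function on `t`-sets
whose sums over all `b`-sets vanish, hence is zero. -/
theorem inducedLinearMap_surjective {F : Type*} [Field F] {v b t : ℕ} (htb : t ≤ b)
    (hv : t + b ≤ v) (hc : ∀ i ≤ t, ((b - i).choose (t - i) : F) ≠ 0) :
    Function.Surjective (inducedLinearMap F v b t) := by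
  classical
  rw [← LinearMap.range_eq_top]
  by_contra hne
  obtain ⟨φ, hφ, hle⟩ := Submodule.exists_le_ker_of_lt_top _ (lt_top_iff_ne_top.2 hne)
  refine hφ ?_
  let f : Finset (Fin v) → F := fun Z => if h : Z.card = t then φ (Pi.single ⟨Z, h⟩ 1) else 0
  have hfφ (Z : DesignBlock v t) : f Z.1 = φ (Pi.single Z 1) := dif_pos Z.2
  have hf := eq_zero_of_sum_powersetCard_eq_zero t b Finset.univ f htb (by simpa using hv) hc (by
    intro Y _ cY
    have h0 : φ (inducedLinearMap F v b t (Pi.single ⟨Y, cY⟩ 1)) = 0 :=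
      hle (LinearMap.mem_range_self _ _)
    rw [LinearMap.pi_apply_eq_sum_univ φ] at h0
    rw [← h0]
    have e (Z : DesignBlock v t) :
        inducedLinearMap F v b t (Pi.single ⟨Y, cY⟩ 1) Z • φ (fun j => if Z = j then 1 else 0)
          = if Z.1 ⊆ Y then f Z.1 else 0 := by
      have hs : (fun j => if Z = j then (1 : F) else 0) = Pi.single Z 1 := by
        ext j
        simp [Pi.single_apply, eq_comm]
      rw [hs, ← hfφ]
      change inducedFun (Pi.single (⟨Y, cY⟩ : DesignBlock v b) (1 : F)) Z.1 • f Z.1 = _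
      rw [inducedFun_single]
      simp
    rw [Finset.sum_congr rfl fun Z _ => e Z,
      sum_designBlock (fun Z => if Z ⊆ Y then f Z else 0), ← Finset.sum_filter]
    refine Finset.sum_congr ?_ fun _ _ => rfl
    ext Z
    simp [Finset.mem_powersetCard, and_comm])
  refine LinearMap.pi_ext' fun Z => LinearMap.ext_ring ?_
  have := hf Z.1 (Finset.subset_univ _) Z.2
  rw [hfφ] at this
  simpa using this

theorem inducedFun_one {R : Type*} [Semiring R] {v b : ℕ} (Z : Finset (Fin v))
    (h : Z.card ≤ b) :
    inducedFun (fun _ : DesignBlock v b => (1 : R)) Z = ((v - Z.card).choose (b - Z.card) : ℕ) := by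
  have := card_filter_superset_powersetCard (Finset.subset_univ Z) h
  rw [Finset.card_univ, Fintype.card_fin] at this
  rw [← this, inducedFun, Finset.sum_filter,
    sum_designBlock (fun Y => if Z ⊆ Y then (1 : R) else 0), ← Finset.sum_filter]
  simp

/-- Double counting of the pairs `Z ⊆ Y` of a `t`-set and a block above a fixed set `X`. -/
theorem IsDesignWithCoeff.mul_choose_eq {R : Type*} [Semiring R] {v b t : ℕ}
    {u : DesignBlock v b → R} {μ : R} (hu : IsDesignWithCoeff u t μ) (X : Finset (Fin v))
    (hX : X.card ≤ t) :
    ((v - X.card).choose (t - X.card) : ℕ) * μ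
      = ((b - X.card).choose (t - X.card) : ℕ) * inducedFun u X := by
  have h1 : ∑ Z ∈ (Finset.univ.powersetCard t).filter (X ⊆ ·), inducedFun u Z
      = ((v - X.card).choose (t - X.card) : ℕ) * μ := by
    rw [Finset.sum_congr rfl fun Z hZ => hu Z
      (Finset.mem_powersetCard.1 (Finset.mem_filter.1 hZ).1).2, Finset.sum_const,
      card_filter_superset_powersetCard (Finset.subset_univ X) hX, nsmul_eq_mul]
    simp
  rw [← h1]
  simp only [inducedFun]
  rw [Finset.mul_sum, Finset.sum_comm' (t' := Finset.univ.filter fun Y : DesignBlock v b => X ⊆ Y.1)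
    (s' := fun Y => (Y.1.powersetCard t).filter (X ⊆ ·))]
  · refine Finset.sum_congr rfl fun Y hY => ?_
    rw [Finset.sum_const, card_filter_superset_powersetCard (Finset.mem_filter.1 hY).2 hX, Y.2,
      nsmul_eq_mul]
  · intro Z Y
    simp only [Finset.mem_filter, Finset.mem_powersetCard, Finset.mem_univ, Finset.subset_univ,
      true_and]
    exact ⟨fun h => ⟨⟨⟨h.2, h.1.1⟩, h.1.2⟩, h.1.2.trans h.2⟩, fun h => ⟨⟨h.1.1.2, h.1.2⟩, h.1.1.1⟩⟩

theorem baseDigit_eq {p : ℕ} (hp : p.Prime) (a l : ℕ) : baseDigit p a l = a / p ^ l % p :=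
  Nat.getD_digits a l hp.two_le

theorem natCast_modEq_neg_one_iff {p d : ℕ} (hd : d < p) :
    (d : ℤ) ≡ -1 [ZMOD (p : ℤ)] ↔ d + 1 = p := by
  rw [Int.modEq_iff_dvd, ← dvd_neg]
  constructor
  · intro h
    have h' : (p : ℤ) ∣ ((d + 1 : ℕ) : ℤ) := by
      rw [Nat.cast_succ]
      simpa using h
    exact le_antisymm hd (Nat.le_of_dvd d.succ_pos (Int.natCast_dvd_natCast.1 h'))
  · rintro rfl
    exact ⟨1, by push_cast; ring⟩

theorem mainTheorem7 (p : ℕ) (hp : p.Prime) (a b l : ℕ) (hab : b ≤ a) (hl : p ^ l ≤ b) :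
    (∃ u : DesignBlock (a + b) b → ZMod p, IsNonNullDesign u (b - p ^ l)) ↔
      (¬ ((baseDigit p a l : ℤ) ≡ -1 [ZMOD (p : ℤ)]) ∨ b < p ^ (l + 1)) := by
  have := Fact.mk hp
  have hpl : 0 < p ^ l := pow_pos hp.pos l
  have hd : a / p ^ l % p < p := Nat.mod_lt _ hp.pos
  rw [baseDigit_eq hp, natCast_modEq_neg_one_iff hd]
  constructor
  · rintro ⟨u, μ, hμ, hu⟩
    by_contra! hcon
    obtain ⟨hdig, hb⟩ := hcon
    have hpow : p ^ (l + 1) = p ^ l * p := pow_succ p l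
    have hle : p ^ l ≤ p ^ (l + 1) := Nat.pow_le_pow_right hp.pos l.le_succ
    obtain ⟨X, -, hX⟩ := Finset.exists_subset_card_eq
      (show b - p ^ (l + 1) ≤ (Finset.univ : Finset (Fin (a + b))).card by
        rw [Finset.card_univ, Fintype.card_fin]; omega)
    have h := hu.mul_choose_eq X (by omega)
    rw [hX, show a + b - (b - p ^ (l + 1)) = a + p ^ (l + 1) by omega,
      show b - (b - p ^ (l + 1)) = p ^ (l + 1) by omega,
      show b - p ^ l - (b - p ^ (l + 1)) = p ^ (l + 1) - p ^ l by omega,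
      Nat.choose_symm hle] at h
    -- The lower index is `(p - 1) * p ^ l`, and adding `p ^ (l + 1)` leaves the digit `a_l = p - 1`
    -- unchanged.
    have e1 : ((a + p ^ (l + 1)).choose (p ^ (l + 1) - p ^ l) : ZMod p) = 1 := by
      rw [hpow]
      have := (ZMod.natCast_eq_natCast_iff _ _ _).2
        (choose_mul_prime_pow_modEq hp (a + p ^ (l + 1)) (p - 1) l (Nat.sub_lt hp.pos one_pos))
      rwa [hpow, Nat.add_mul_div_left _ _ hpl, Nat.add_mod_right, ← Nat.eq_sub_of_add_eq hdig,
        Nat.choose_self, Nat.cast_one, Nat.eq_sub_of_add_eq hdig, Nat.sub_mul, one_mul,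
        mul_comm p] at this
    have e2 : ((p ^ (l + 1)).choose (p ^ l) : ZMod p) = 0 := by
      have := (ZMod.natCast_eq_natCast_iff _ _ _).2
        (choose_mul_prime_pow_modEq hp (p ^ (l + 1)) 1 l hp.one_lt)
      rw [hpow, Nat.mul_div_cancel_left _ hpl] at this
      simpa [hpow] using this
    rw [e1, e2, one_mul, zero_mul] at h
    exact hμ h
  · rintro (hdig | hb)
    · refine ⟨fun _ => 1, ((a + p ^ l).choose (p ^ l) : ℕ), ?_, fun Z hZ => ?_⟩
      · have := (ZMod.natCast_eq_natCast_iff _ _ _).2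
          (choose_mul_prime_pow_modEq hp (a + p ^ l) 1 l hp.one_lt)
        rw [one_mul] at this
        rw [this, Nat.add_div_right _ hpl, Nat.choose_one_right, Ne, ZMod.natCast_eq_zero_iff,
          Nat.dvd_mod_iff dvd_rfl]
        intro hdvd
        apply hdig
        have h2 : p ∣ a / p ^ l % p + 1 := by
          rw [Nat.dvd_iff_mod_eq_zero] at hdvd ⊢
          rw [Nat.mod_add_mod]
          exact hdvd
        exact le_antisymm hd (Nat.le_of_dvd (Nat.succ_pos _) h2)
      · rw [inducedFun_one Z (by omega), hZ, show a + b - (b - p ^ l) = a + p ^ l by omega,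
          show b - (b - p ^ l) = p ^ l by omega]
    · obtain ⟨u, hu⟩ := inducedLinearMap_surjective (F := ZMod p) (v := a + b) (b := b)
        (t := b - p ^ l) (by omega) (by omega) (fun i hi => by
          rw [← Nat.choose_symm (by omega), show b - i - (b - p ^ l - i) = p ^ l by omega]
          have := (ZMod.natCast_eq_natCast_iff _ _ _).2
            (choose_mul_prime_pow_modEq hp (b - i) 1 l hp.one_lt)
          rw [one_mul] at this
          -- Since `p ^ l ≤ b - i < p ^ (l + 1)`, this quotient is a nonzero digit, and it is the
          -- binomial mod `p`.
          have hlt : (b - i) / p ^ l < p := by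
            rw [Nat.div_lt_iff_lt_mul hpl, ← pow_succ']
            omega
          have hpos : 0 < (b - i) / p ^ l := Nat.div_pos (by omega) hpl
          rw [this, Nat.mod_eq_of_lt hlt, Nat.choose_one_right, Ne, ZMod.natCast_eq_zero_iff]
          exact fun h => absurd (Nat.le_of_dvd hpos h) (by omega)) (fun _ => 1)
      exact ⟨u, 1, one_ne_zero, fun Z hZ => congrFun hu ⟨Z, hZ⟩⟩
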